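/- \textbf{Setting.} A meet semi-lattice $L$ with minimum $\hat 0$ is \emph{ranked} if it has a rank function $r:L\to\mathbb N$ with $r(\hat 0)=0$ that increases by one along cover relations; $L_i$ denotes the set of elements of rank $i$, and $f(L)=(f_{-1},f_0,\dots)$ with $f_{i-1}(L)=|L_i|$. A finite ranked meet semi-lattice $L$ is \emph{geometric} if every element is a join of atoms and $r(x\wedge y)+r(x\vee y)\le r(x)+r(y)$ for all $x,y\in L$ such that $x\vee y$ exists. Let $\hat L$ be $L$ with a new maximum $\hat 1$ added. Let $k$ be a field of characteristic $2$, let $n=|L_1|$, and fix a total ordering of $L_1$, that is, a bijection $L_1\cong\{1,\dots,n\}$. Let $V$ be the $k$-vector space with basis $\{e_u:u\in L_1\}$, write $e_S=e_{s_1}\wedge\dots\wedge e_{s_m}$ for $S=\{s_1<\dots<s_m\}\subseteq L_1$, and put $\bigwedge L=\bigwedge V/I_L$, where $I_L$ is the ideal generated by (1) all $e_S$ with $\bigvee S=\hat 1$ in $\hat L$; (2) all $e_S$ with $\bigvee S\in L$ and $r(\bigvee S)\neq|S|$; (3) all $e_S-e_T$ with $S\ne T$, $\bigvee S=\bigvee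 T\in L$ and $r(\bigvee S)=|S|=|T|$. For a basis $B=(b_1,\dots,b_n)$ of $V$ let $\tilde b_S$ be the image of $b_S=b_{s_1}\wedge\dots\wedge b_{s_m}$ in $\bigwedge L$, for $S=\{s_1<\dots<s_m\}\subseteq\{1,\dots,n\}$, and let $$\Delta_B(L)=\{S\subseteq\{1,\dots,n\}:\ \tilde b_S\notin\operatorname{span}_k\{\tilde b_T:|T|=|S|,\ T<_{\mathrm{lex}}S\}\},$$ where $T<_{\mathrm{lex}}S$ iff $\min(S\triangle T)\in T$. Call $B$ \emph{generic} if the entries of the transition matrix from the basis $(e_u)$ to $B$ are algebraically independent over a subfield of $k$. Let $\Delta(L)$ be $\Delta_B(L)$ computed over the extension of $k$ by $n^2$ indeterminates, with $B$ the basis whose transition matrix has these indeterminates as its entries. \textbf{Theorem.} Let $L$ be a finite geometric meet semi-lattice and let $k$ be a field of characteristic $2$. Then $\Delta(L)$ is a simplicial complex (with $\emptyset\in\Delta(L)$); it is shifted, i.e. if $S\in\Delta(L)$ and $T\subseteq\{1,\dots,n\}$ has the same size as $S$ and is componentwise not greater than $S$ (both listed increasingly), then $T\in\Delta(L)$; and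 $f(\Delta(L))=f(L)$, i.e. for every $i\ge0$ the number of $S\in\Delta(L)$ with $|S|=i$ is $|L_i|$. Moreover $\Delta(L)$ is canonical: it depends neither on the total ordering of $L_1$ nor on the field $k$ of characteristic $2$, and for every field $k'$ of characteristic $2$, every total ordering of $L_1$ and every generic basis $B$ over $k'$ one has $\Delta_B(L)=\Delta(L)$. -/

import Mathlib

open Module

noncomputable section

namespace GeometricShift

/-! ### Geometric meet semi-lattices -/

/-- A ranked meet semi-lattice with minimum `⊥` (the rank function is `grade ℕ`, which is `0` at
`⊥` and increases by one along covers) is geometric if it is atomic and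
`r (x ∧ y) + r (x ∨ y) ≤ r x + r y` whenever the join `x ∨ y` exists. -/
structure IsGeometric (L : Type*) [SemilatticeInf L] [OrderBot L] [GradeMinOrder ℕ L] : Prop where
  atomistic : IsAtomistic L
  grade_inf_add_grade_sup_le : ∀ x y j : L, IsLUB {x, y} j →
    grade ℕ (x ⊓ y) + grade ℕ j ≤ grade ℕ x + grade ℕ y

/-- The set of elements of rank one. -/
abbrev RankOne (L : Type*) [Preorder L] [GradeOrder ℕ L] : Type _ :=
  {x : L // grade ℕ x = 1}

/-- The number of elements of rank `i`, that is, the entry `f_{i-1}` of the `f`-vector. -/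
def fPoset (L : Type*) [Preorder L] [GradeOrder ℕ L] (i : ℕ) : ℕ :=
  Nat.card {x : L // grade ℕ x = i}

/-! ### Simplicial complexes on the vertices `0, …, n - 1` -/

/-- A simplicial complex, with the empty set counted among its faces. -/
structure IsComplex {n : ℕ} (A : Set (Finset (Fin n))) : Prop where
  empty_mem : ∅ ∈ A
  down_closed : ∀ S ∈ A, ∀ T ⊆ S, T ∈ A

/-- The number of faces with `i` vertices, that is, the entry `f_{i-1}` of the `f`-vector. -/
def fComplex {n : ℕ} (A : Set (Finset (Fin n))) (i : ℕ) : ℕ :=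
  Nat.card {S : Finset (Fin n) // S ∈ A ∧ S.card = i}

/-- `A` is shifted: if `S ∈ A` and `T` is a set of the same size, componentwise at most `S` when
both are listed increasingly, then `T ∈ A`. -/
def IsShifted {n : ℕ} (A : Set (Finset (Fin n))) : Prop :=
  ∀ S ∈ A, ∀ (T : Finset (Fin n)) (h : T.card = S.card),
    (∀ i : Fin S.card, T.orderEmbOfFin h i ≤ S.orderEmbOfFin rfl i) → T ∈ A

/-- The lexicographic order: `S < T` iff `min (S ∆ T) ∈ S`. -/
def LexLT {n : ℕ} (S T : Finset (Fin n)) : Prop :=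
  ∃ h : (symmDiff S T).Nonempty, (symmDiff S T).min' h ∈ S

/-! ### The exterior face algebra

A total ordering of the elements of rank one is given as a bijection `σ : Fin n ≃ RankOne L`;
subsets of `RankOne L` are then written as finite subsets of `Fin n`. -/

/-- The wedge product `v_{s₁} ∧ ⋯ ∧ v_{sₘ}`, where `S = {s₁ < ⋯ < sₘ}`. -/
def wedge (k : Type*) [Field k] {V : Type*} [AddCommGroup V] [Module k V] {n : ℕ}
    (v : Fin n → V) (S : Finset (Fin n)) : ExteriorAlgebra k V :=
  ExteriorAlgebra.ιMulti k S.card (fun i => v (S.orderEmbOfFin rfl i))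

variable {L : Type*} [SemilatticeInf L] [OrderBot L] [GradeMinOrder ℕ L] {n : ℕ}

/-- `l` is the join in `L` of the rank one elements indexed by `S`. -/
def IsJoin (σ : Fin n ≃ RankOne L) (S : Finset (Fin n)) (l : L) : Prop :=
  IsLUB ((fun i => (σ i : L)) '' (S : Set (Fin n))) l

/-- The join of the rank one elements indexed by `S`, taken in `L` with a new maximum added, is
that maximum. -/
def IsJoinTop (σ : Fin n ≃ RankOne L) (S : Finset (Fin n)) : Prop :=
  IsLUB ((fun i => ((σ i : L) : WithTop L)) '' (S : Set (Fin n))) ⊤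

/-- The standard basis `e_u` of the vector space `V` with basis `RankOne L`, listed in the order
given by `σ`. -/
def stdBasis (k : Type*) [Field k] (σ : Fin n ≃ RankOne L) : Basis (Fin n) k (RankOne L →₀ k) :=
  (Finsupp.basisSingleOne (R := k) (ι := RankOne L)).reindex σ.symm

/-- The generators of `I₁`. -/
def gens₁ (k : Type*) [Field k] (σ : Fin n ≃ RankOne L) :
    Set (ExteriorAlgebra k (RankOne L →₀ k)) :=
  {w | ∃ S : Finset (Fin n), IsJoinTop σ S ∧ w = wedge k (stdBasis k σ) S}

/-- The generators of `I₂`. -/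
def gens₂ (k : Type*) [Field k] (σ : Fin n ≃ RankOne L) :
    Set (ExteriorAlgebra k (RankOne L →₀ k)) :=
  {w | ∃ (S : Finset (Fin n)) (l : L), IsJoin σ S l ∧ grade ℕ l ≠ S.card ∧
    w = wedge k (stdBasis k σ) S}

/-- The generators of `I₃`. -/
def gens₃ (k : Type*) [Field k] (σ : Fin n ≃ RankOne L) :
    Set (ExteriorAlgebra k (RankOne L →₀ k)) :=
  {w | ∃ (S T : Finset (Fin n)) (l : L), IsJoin σ S l ∧ IsJoin σ T l ∧
    grade ℕ l = S.card ∧ grade ℕ l = T.card ∧ S ≠ T ∧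
    w = wedge k (stdBasis k σ) S - wedge k (stdBasis k σ) T}

/-- The two-sided ideal `I_L` of `⋀ V`. -/
def faceIdeal (k : Type*) [Field k] (σ : Fin n ≃ RankOne L) :
    TwoSidedIdeal (ExteriorAlgebra k (RankOne L →₀ k)) :=
  TwoSidedIdeal.span (gens₁ k σ ∪ gens₂ k σ ∪ gens₃ k σ)

/-- The algebra `⋀ L = ⋀ V / I_L`. -/
abbrev FaceAlgebra (k : Type*) [Field k] (σ : Fin n ≃ RankOne L) : Type _ :=
  (faceIdeal k σ).ringCon.Quotient

/-- The image in `⋀ L` of `v_{s₁} ∧ ⋯ ∧ v_{sₘ}`, where `S = {s₁ < ⋯ < sₘ}`. -/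
def faceWedge (k : Type*) [Field k] (σ : Fin n ≃ RankOne L) (v : Fin n → RankOne L →₀ k)
    (S : Finset (Fin n)) : FaceAlgebra k σ :=
  (faceIdeal k σ).ringCon.mk' (wedge k v S)

/-! ### Exterior algebraic shifting -/

/-- `Δ_B(L)`: the sets `S` for which the image of `b_S` in `⋀ L` is not in the span of the images
of the `b_T` with `|T| = |S|` and `T` lexicographically smaller than `S`. -/
def shiftWrt (k : Type*) [Field k] (σ : Fin n ≃ RankOne L)
    (B : Basis (Fin n) k (RankOne L →₀ k)) : Set (Finset (Fin n)) :=
  {S | faceWedge k σ B S ∉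
    Submodule.span k {w | ∃ T : Finset (Fin n), T.card = S.card ∧ LexLT T S ∧
      w = faceWedge k σ B T}}

/-- `B` is generic: the entries of the transition matrix from the standard basis to `B` are
algebraically independent over some subfield of `k`. -/
def IsGeneric (k : Type*) [Field k] (σ : Fin n ≃ RankOne L)
    (B : Basis (Fin n) k (RankOne L →₀ k)) : Prop :=
  ∃ F : Subfield k,
    AlgebraicIndependent F (fun p : Fin n × Fin n => (stdBasis k σ).toMatrix B p.1 p.2)

/-- The extension of `k` by `n²` indeterminates. -/
abbrev GenericField (k : Type*) [Field k] (n : ℕ) : Type _ :=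
  FractionRing (MvPolynomial (Fin n × Fin n) k)

/-- The `n × n` matrix of indeterminates. -/
def genericMatrix (k : Type*) [Field k] (n : ℕ) : Matrix (Fin n) (Fin n) (GenericField k n) :=
  (Matrix.mvPolynomialX (Fin n) (Fin n) k).map (algebraMap _ (GenericField k n))

theorem isUnit_det_genericMatrix (k : Type*) [Field k] (n : ℕ) :
    IsUnit (genericMatrix k n).det := by
  have h : (genericMatrix k n).det =
      algebraMap _ (GenericField k n) (Matrix.mvPolynomialX (Fin n) (Fin n) k).det := by
    rw [RingHom.map_det]; rfl
  rw [isUnit_iff_ne_zero, h]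
  exact fun h0 => Matrix.det_mvPolynomialX_ne_zero (Fin n) k
    ((IsFractionRing.injective _ (GenericField k n)) (by rw [h0, map_zero]))

/-- The basis, over the extended field, whose transition matrix from the standard basis is the
matrix of indeterminates. -/
def genericBasis (k : Type*) [Field k] (σ : Fin n ≃ RankOne L) :
    Basis (Fin n) (GenericField k n) (RankOne L →₀ GenericField k n) :=
  (stdBasis (GenericField k n) σ).map
    (LinearEquiv.ofIsUnitDet (v := stdBasis (GenericField k n) σ)
      (v' := stdBasis (GenericField k n) σ)
      (f := Matrix.toLin (stdBasis (GenericField k n) σ) (stdBasis (GenericField k n) σ)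
        (genericMatrix k n))
      (by rw [LinearMap.toMatrix_toLin]; exact isUnit_det_genericMatrix k n))

theorem stdBasis_toMatrix_genericBasis (k : Type*) [Field k] (σ : Fin n ≃ RankOne L) :
    (stdBasis (GenericField k n) σ).toMatrix (genericBasis k σ) = genericMatrix k n := by
  ext i j
  simp [genericBasis, Basis.toMatrix_apply, Matrix.toLin_self, Finsupp.single_apply]

/-- `Δ(L)`, computed over `k`: the generic exterior algebraic shifting of `⋀ L`, with `k` extended
by `n²` indeterminates, which are the entries of the transition matrix. -/
def genericShift (k : Type*) [Field k] (σ : Fin n ≃ RankOne L) : Set (Finset (Fin n)) :=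
  shiftWrt (GenericField k n) σ (genericBasis k σ)

end GeometricShift

end

open Module

noncomputable section

namespace GeometricShift

/-! ### Joins in a geometric meet semi-lattice -/

section Lattice

set_option linter.unusedSectionVars false

variable {L : Type*} [SemilatticeInf L] [OrderBot L] [GradeMinOrder ℕ L]

/-! Let each atom `u` act on the vector space with basis `L` by `x ↦ x ∨ u` when this join exists
and has rank one more than `x`, and by `0` otherwise. Submodularity makes these operators commute,
and they square to zero. The commutative algebra they generate acts on the basis vector of `⊥` as a
cyclic vector, so evaluation there identifies it with the whole space (`ev_injective`,
`exists_ev_eq_single`). In characteristic 2 every linear form in the operators squares to zero, so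
the exterior algebra maps to this algebra, and `⋀ L` embeds in it (`faceHom_injective`). Each `b_S`
thus becomes a product of commuting linear forms, with coordinate vector `coord` in the basis `L`.

The claims now concern the lexicographically greedy basis of these vectors. Multiplying a dependence
by further factors gives the complex; the span of the products of `i` factors is the rank `i` part,
which gives the `f`-vector. Coordinates are integer polynomials in the entries of the matrix, and
every generic matrix is the image of the universal one over `ℤ/2` under a field embedding, so all
have the same greedy set; this is canonicity. Shiftedness follows: replacing `b_i` by `b_i + b_j`
keeps the matrix generic and moves `S ∋ j` to `S - j + i`. -/

theorem covBy_of_le_of_grade {x y : L} (h : x ≤ y) (hg : grade ℕ y = grade ℕ x + 1) : x ⋖ y := by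
  refine (covBy_iff_lt_covBy_grade (𝕆 := ℕ)).2 ⟨lt_of_le_of_ne h ?_, ?_⟩
  · rintro rfl
    omega
  · rw [hg]
    exact Order.covBy_add_one _

theorem grade_of_covBy {x y : L} (h : x ⋖ y) : grade ℕ y = grade ℕ x + 1 :=
  (Order.covBy_iff_add_one_eq.1 (h.grade ℕ)).symm

theorem eq_of_le_of_grade_le {x y : L} (h : x ≤ y) (hg : grade ℕ y ≤ grade ℕ x) : x = y := by
  by_contra hne
  exact absurd (grade_strictMono (𝕆 := ℕ) (lt_of_le_of_ne h hne)) (not_lt.2 hg)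

theorem exists_isLUB_of_bddAbove [Finite L] {s : Set L} (hs : BddAbove s) : ∃ j, IsLUB s j := by
  classical
  have := Fintype.ofFinite L
  obtain ⟨b, hb⟩ := hs
  have hne : (Finset.univ.filter fun x => x ∈ upperBounds s).Nonempty := ⟨b, by simpa using hb⟩
  refine ⟨(Finset.univ.filter fun x => x ∈ upperBounds s).inf' hne id, fun x hx => ?_,
    fun y hy => ?_⟩
  · refine Finset.le_inf' _ _ fun y hy => ?_
    exact (by simpa using hy : y ∈ upperBounds s) hx
  · exact Finset.inf'_le id (by simpa using hy)

/-- `y` covers `x` and is the join of `x` with the atom `u`. -/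
def Step (u : RankOne L) (x y : L) : Prop := x ⋖ y ∧ (u : L) ≤ y ∧ ¬ (u : L) ≤ x

/-- The meet `y ⊓ z` lies strictly above `x` because it is above `u`, so the cover `x ⋖ y` forces it
to be `y`. Hence a step always lands on the join of `x` and `u`. -/
theorem Step.le_of_le {u : RankOne L} {x y z : L} (h : Step u x y) (hx : x ≤ z)
    (hu : (u : L) ≤ z) : y ≤ z := by
  have h1 : x ≤ y ⊓ z := le_inf h.1.le hx
  have h2 : x < y ⊓ z := lt_of_le_of_ne h1 fun he => h.2.2 (he ▸ le_inf h.2.1 hu)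
  have h3 : y ⊓ z = y := by
    by_contra hne
    exact h.1.2 h2 (lt_of_le_of_ne inf_le_left hne)
  exact inf_eq_left.1 h3

theorem Step.unique {u : RankOne L} {x y z : L} (h : Step u x y) (h' : Step u x z) : y = z :=
  le_antisymm (h.le_of_le h'.1.le h'.2.1) (h'.le_of_le h.1.le h.2.1)

variable [Finite L] (hL : IsGeometric L)
include hL

/-- A bounded set in a finite meet semi-lattice has a join; the rank bound is submodularity with the
rank of the meet dropped. -/
theorem IsGeometric.exists_isLUB_pair {u : RankOne L} {x y : L} (hx : x ≤ y) (hu : (u : L) ≤ y) :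
    ∃ j, IsLUB {x, (u : L)} j ∧ grade ℕ j ≤ grade ℕ x + 1 := by
  obtain ⟨j, hj⟩ := exists_isLUB_of_bddAbove (s := {x, (u : L)}) ⟨y, by
    rintro z (rfl | rfl) <;> assumption⟩
  have := hL.grade_inf_add_grade_sup_le x u j hj
  rw [u.2] at this
  exact ⟨j, hj, by omega⟩

theorem IsGeometric.exists_step {u : RankOne L} {x y : L} (hx : x ≤ y) (hu : (u : L) ≤ y)
    (hux : ¬ (u : L) ≤ x) : ∃ j, Step u x j ∧ j ≤ y := by
  obtain ⟨j, hj, hg⟩ := hL.exists_isLUB_pair hx hu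
  have hxj : x ≤ j := hj.1 (by simp)
  have huj : (u : L) ≤ j := hj.1 (by simp)
  have hlt : x < j := lt_of_le_of_ne hxj fun h => hux (h ▸ huj)
  have := grade_strictMono (𝕆 := ℕ) hlt
  refine ⟨j, ⟨covBy_of_le_of_grade hxj (by omega), huj, hux⟩, hj.2 ?_⟩
  rintro z (rfl | rfl) <;> assumption

/-- If `w ≤ y'`, then `y ≤ y'` with equal ranks, so `u ≤ y`, a contradiction. This is the source of
commutativity of the join operators. -/
theorem IsGeometric.step_comm {u w : RankOne L} {x y z : L} (h₁ : Step w x y) (h₂ : Step u y z) :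
    ∃ y', Step u x y' ∧ Step w y' z := by
  obtain ⟨y', hy', hle⟩ := hL.exists_step (u := u) (x := x) (y := z) (h₁.1.le.trans h₂.1.le) h₂.2.1
    fun h => h₂.2.2 (h.trans h₁.1.le)
  have e1 := grade_of_covBy h₁.1
  have e2 := grade_of_covBy h₂.1
  have e3 := grade_of_covBy hy'.1
  refine ⟨y', hy', covBy_of_le_of_grade hle (by omega), h₁.2.1.trans h₂.1.le, fun hw => ?_⟩
  have := eq_of_le_of_grade_le (h₁.le_of_le hy'.1.le hw) (by omega)
  exact h₂.2.2 (this ▸ hy'.2.1)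

theorem IsGeometric.exists_isLUB_grade_le {ι : Type*} (σ : ι → RankOne L) (S : Finset ι) {y : L}
    (hy : ∀ i ∈ S, (σ i : L) ≤ y) :
    ∃ x, IsLUB ((fun i => (σ i : L)) '' (S : Set ι)) x ∧ grade ℕ x ≤ S.card := by
  classical
  induction S using Finset.induction_on with
  | empty => exact ⟨⊥, by simp, by simp [grade_bot]⟩
  | insert a S ha ih =>
    obtain ⟨x, hx, hg⟩ := ih fun i hi => hy i (by simp [hi])
    have hxy : x ≤ y := hx.2 (by rintro _ ⟨i, hi, rfl⟩; exact hy i (by simp at hi; simp [hi]))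
    obtain ⟨j, hj, hg'⟩ := hL.exists_isLUB_pair hxy (hy a (by simp))
    refine ⟨j, ?_, by rw [Finset.card_insert_of_notMem ha]; omega⟩
    rw [Finset.coe_insert, Set.image_insert_eq]
    constructor
    · rintro _ (rfl | h)
      · exact hj.1 (by simp)
      · exact (hx.1 h).trans (hj.1 (by simp))
    · intro z hz
      refine hj.2 ?_
      rintro _ (rfl | rfl)
      · exact hx.2 fun b hb => hz (Or.inr hb)
      · exact hz (Or.inl rfl)

omit [Finite L] hL in
theorem isJoin_insert {n : ℕ} {σ : Fin n ≃ RankOne L} {S : Finset (Fin n)} {a : Fin n} {x l : L}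
    (hx : IsJoin σ S x) (h : Step (σ a) x l) : IsJoin σ (insert a S) l := by
  unfold IsJoin at *
  rw [Finset.coe_insert, Set.image_insert_eq]
  constructor
  · rintro _ (rfl | hb)
    · exact h.2.1
    · exact (hx.1 hb).trans h.1.le
  · intro z hz
    exact h.le_of_le (hx.2 fun b hb => hz (Or.inr hb)) (hz (Or.inl rfl))

/-- A subset of an independent set of atoms is independent: each atom raises the rank by at most
one, so reaching the full rank leaves no slack. -/
theorem IsGeometric.exists_step_of_isJoin_insert {n : ℕ} {σ : Fin n ≃ RankOne L}
    {S : Finset (Fin n)} {a : Fin n} (ha : a ∉ S) {l : L} (hl : IsJoin σ (insert a S) l)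
    (hg : grade ℕ l = (insert a S).card) :
    ∃ x, IsJoin σ S x ∧ grade ℕ x = S.card ∧ Step (σ a) x l := by
  rw [Finset.card_insert_of_notMem ha] at hg
  have hle : ∀ i ∈ insert a S, (σ i : L) ≤ l := fun i hi => hl.1 ⟨i, by simpa using hi, rfl⟩
  obtain ⟨x, hx, hxg⟩ := hL.exists_isLUB_grade_le σ S (y := l) fun i hi => hle i (by simp [hi])
  have hxl : x ≤ l := hx.2 (by rintro _ ⟨i, hi, rfl⟩; exact hle i (by simp at hi; simp [hi]))
  have hax : ¬ (σ a : L) ≤ x := by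
    intro hax
    have : l ≤ x := hl.2 (by
      rintro _ ⟨i, hi, rfl⟩
      rcases Finset.mem_insert.1 (Finset.mem_coe.1 hi) with rfl | hi
      · exact hax
      · exact hx.1 ⟨i, hi, rfl⟩)
    have := grade_mono (𝕆 := ℕ) this
    omega
  obtain ⟨j, hj, hjl⟩ := hL.exists_step hxl (hle a (by simp)) hax
  obtain rfl : j = l := (isJoin_insert hx hj).unique hl
  have := grade_of_covBy hj.1
  exact ⟨x, hx, by omega, hj⟩

omit [Finite L] in
-- Otherwise all atoms below `y` lie below `x`, and so does their join `y`. This is the one use of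
-- atomicity.
theorem IsGeometric.exists_step_to {x y : L} (h : x ⋖ y) : ∃ u : RankOne L, Step u x y := by
  obtain ⟨s, hs, hat⟩ := hL.atomistic.isLUB_atoms y
  by_contra hcon
  push Not at hcon
  refine h.1.not_ge (hs.2 fun a ha => ?_)
  by_contra hax
  have hg : grade ℕ a = 1 := by
    rw [grade_of_covBy (bot_covBy_iff.2 (hat a ha)), grade_bot]
    rfl
  exact hcon ⟨a, hg⟩ ⟨h, hs.1 ha, hax⟩

omit hL in
theorem exists_covBy_of_grade_eq_succ {l : L} {i : ℕ} (h : grade ℕ l = i + 1) :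
    ∃ x, x ⋖ l ∧ grade ℕ x = i := by
  have hl : (⊥ : L) < l := bot_lt_iff_ne_bot.2 fun hm => by
    rw [hm, grade_bot] at h
    simp at h
  obtain ⟨x, -, hx⟩ := exists_le_covBy_of_lt hl
  have := grade_of_covBy hx
  exact ⟨x, hx, by omega⟩

end Lattice

/-! ### The lexicographic order and shifted families -/

section Lex

variable {n : ℕ}

theorem lexLT_iff {S T : Finset (Fin n)} :
    LexLT S T ↔ ∃ i ∈ S, i ∉ T ∧ ∀ j < i, (j ∈ S ↔ j ∈ T) := by
  constructor
  · rintro ⟨h, hm⟩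
    have h1 := Finset.min'_mem _ h
    refine ⟨_, hm, ?_, fun j hj => ?_⟩
    · rw [Finset.mem_symmDiff] at h1
      tauto
    · by_contra hc
      have : j ∈ symmDiff S T := by
        rw [Finset.mem_symmDiff]
        tauto
      exact absurd (Finset.min'_le _ _ this) (not_le.2 hj)
  · rintro ⟨i, hS, hT, hj⟩
    have hi : i ∈ symmDiff S T := by
      rw [Finset.mem_symmDiff]
      tauto
    have : (symmDiff S T).min' ⟨i, hi⟩ = i := by
      refine le_antisymm (Finset.min'_le _ _ hi) (Finset.le_min' _ _ _ fun j hjm => ?_)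
      by_contra hlt
      have := hj j (not_le.1 hlt)
      rw [Finset.mem_symmDiff] at hjm
      tauto
    exact ⟨⟨i, hi⟩, by rwa [this]⟩

/-- The indicator of the complement of `S`, which turns `LexLT` into the lexicographic order of
functions. -/
def lexKey (S : Finset (Fin n)) : Lex (Fin n → Bool) := toLex fun i => decide (i ∉ S)

theorem lexLT_iff_lexKey {S T : Finset (Fin n)} : LexLT S T ↔ lexKey S < lexKey T := by
  rw [lexLT_iff]
  constructor
  · rintro ⟨i, hS, hT, h⟩
    exact ⟨i, fun j hj => by simp [lexKey, h j hj], by simp [lexKey, hS, hT]⟩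
  · rintro ⟨i, h, hi⟩
    have hi' : i ∈ S ∧ i ∉ T := by
      simpa [lexKey, Bool.lt_iff] using hi
    refine ⟨i, hi'.1, hi'.2, fun j hj => ?_⟩
    have := h j hj
    simp [lexKey] at this
    tauto

theorem lexKey_injective : Function.Injective (lexKey (n := n)) := by
  intro S T h
  ext i
  have := congrFun (toLex.injective h) i
  simp at this
  tauto

theorem LexLT.trans {R S T : Finset (Fin n)} (h : LexLT R S) (h' : LexLT S T) : LexLT R T :=
  lexLT_iff_lexKey.2 ((lexLT_iff_lexKey.1 h).trans (lexLT_iff_lexKey.1 h'))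

theorem LexLT.union {R T U : Finset (Fin n)} (h : LexLT R T) (hU : Disjoint R U) :
    LexLT (R ∪ U) (T ∪ U) := by
  rw [lexLT_iff] at *
  obtain ⟨i, hR, hT, h⟩ := h
  refine ⟨i, by simp [hR], ?_, fun j hj => by simp [h j hj]⟩
  simp [hT, Finset.disjoint_left.1 hU hR]

theorem lexLT_insert_erase {S : Finset (Fin n)} {i j : Fin n} (hij : i < j) (hi : i ∉ S) :
    LexLT (insert i (S.erase j)) S := by
  rw [lexLT_iff]
  refine ⟨i, by simp, hi, fun l hl => ?_⟩
  have h1 : l ≠ i := hl.ne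
  have h2 : l ≠ j := (hl.trans hij).ne
  simp [h1, h2]

/-- The first difference between `R` and `S - j + i` is neither `i` nor `j`, since the two sets
agree there; undoing the swap in both leaves it in place. -/
theorem LexLT.exchange {R S : Finset (Fin n)} {i j : Fin n} (hj : j ∈ S) (hi : i ∉ S)
    (hiR : i ∈ R) (hjR : j ∉ R) (h : LexLT R (insert i (S.erase j))) :
    LexLT (insert j (R.erase i)) S := by
  rw [lexLT_iff] at *
  have hij : i ≠ j := by
    rintro rfl
    exact hi hj
  obtain ⟨l, hl, hl', h⟩ := h
  have hli : l ≠ i := fun e => hl' (by simp [e])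
  have hlj : l ≠ j := fun e => hjR (e ▸ hl)
  refine ⟨l, by simp [hli, hl], ?_, fun m hm => ?_⟩
  · simpa [hli, hlj] using hl'
  · have := h m hm
    by_cases hmi : m = i
    · subst hmi
      simp [hij, hi]
    · by_cases hmj : m = j
      · subst hmj
        simp [hj]
      · simpa [hmi, hmj] using this

/-- A family of sets which is closed under replacing an element by a smaller one is shifted. -/
theorem isShifted_of_exchange {A : Set (Finset (Fin n))}
    (hA : ∀ S ∈ A, ∀ i j, i < j → i ∉ S → j ∈ S → insert i (S.erase j) ∈ A) : IsShifted A := by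
  -- Componentwise comparison is restated by counting elements up to each `c`, which suits an
  -- induction on `|S \ T|`.
  have key : ∀ (m : ℕ) (S T : Finset (Fin n)), S ∈ A → (S \ T).card = m → T.card = S.card →
      (∀ c, (S.filter (· ≤ c)).card ≤ (T.filter (· ≤ c)).card) → T ∈ A := by
    intro m
    induction m with
    | zero =>
      intro S T hS h0 hc _
      rw [Finset.card_eq_zero, Finset.sdiff_eq_empty_iff_subset] at h0
      rwa [← Finset.eq_of_subset_of_card_le h0 hc.le]
    | succ m ih =>
      intro S T hS hm hc hle
      have hne : (S \ T).Nonempty := Finset.card_pos.1 (by omega)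
      obtain ⟨hjS, hjT⟩ := Finset.mem_sdiff.1 (Finset.min'_mem _ hne)
      set j := (S \ T).min' hne with hj
      have hsub : ∀ l ∈ S, l < j → l ∈ T := by
        intro l hl hlj
        by_contra hlT
        exact absurd (Finset.min'_le (S \ T) l (by simp [hl, hlT])) (not_le.2 hlj)
      -- Below `j` the set `S` is contained in `T`, and `j ∉ T`; the count at `c = j` then forces an
      -- element of `T \ S` below `j`.
      have hex : ∃ i ∈ T, i ∉ S ∧ i < j := by
        by_contra hcon
        push Not at hcon
        have : T.filter (· ≤ j) ⊂ S.filter (· ≤ j) := by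
          refine Finset.ssubset_iff_subset_ne.2 ⟨fun l hl => ?_, fun he => ?_⟩
          · rw [Finset.mem_filter] at hl ⊢
            refine ⟨?_, hl.2⟩
            by_contra hlS
            have := le_antisymm hl.2 (hcon l hl.1 hlS)
            exact hjT (this ▸ hl.1)
          · have : j ∈ T.filter (· ≤ j) := he ▸ by simp [hjS]
            exact hjT (Finset.mem_filter.1 this).1
        exact absurd (Finset.card_lt_card this) (not_lt.2 (hle j))
      obtain ⟨i, hiT, hiS, hij⟩ := hex
      have hcard : (insert i (S.erase j)).card = S.card := by
        rw [Finset.card_insert_of_notMem (by simp [hiS]), Finset.card_erase_add_one hjS]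
      refine ih _ T (hA S hS i j hij hiS hjS) ?_ (by rw [hc, hcard]) fun c => ?_
      · have : insert i (S.erase j) \ T = (S \ T).erase j := by
          ext l
          simp only [Finset.mem_sdiff, Finset.mem_insert, Finset.mem_erase]
          constructor
          · rintro ⟨rfl | h, h'⟩
            · exact absurd hiT h'
            · exact ⟨h.1, h.2, h'⟩
          · rintro ⟨h1, h2, h3⟩
            exact ⟨Or.inr ⟨h1, h2⟩, h3⟩
        rw [this, Finset.card_erase_of_mem (by simp [hjS, hjT]), hm]
        rfl
      -- Up to a threshold below `j` the new set is contained in `T`; from `j` on, the swap does not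
      -- increase the count for `S`.
      · rcases lt_or_ge c j with hcj | hcj
        · refine Finset.card_le_card fun l hl => ?_
          simp only [Finset.mem_filter, Finset.mem_insert, Finset.mem_erase] at hl ⊢
          refine ⟨?_, hl.2⟩
          rcases hl.1 with rfl | h
          · exact hiT
          · exact hsub l h.2 (hl.2.trans_lt hcj)
        · refine le_trans ?_ (hle c)
          have hj' : j ∈ S.filter (· ≤ c) := by simp [hjS, hcj]
          rw [← Finset.card_erase_add_one hj']
          refine le_trans (Finset.card_le_card (t := insert i ((S.filter (· ≤ c)).erase j)) ?_)
            (Finset.card_insert_le _ _)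
          intro l hl
          simp only [Finset.mem_filter, Finset.mem_insert, Finset.mem_erase] at hl ⊢
          tauto
  intro S hS T h hle
  refine key _ S T hS rfl h fun c => ?_
  have hS' : (S.filter (· ≤ c)).card =
      (Finset.univ.filter fun i : Fin S.card => S.orderEmbOfFin rfl i ≤ c).card := by
    rw [← Finset.card_map (S.orderEmbOfFin rfl).toEmbedding]
    congr 1
    ext l
    simp only [Finset.mem_filter, Finset.mem_map, Finset.mem_univ, true_and,
      RelEmbedding.coe_toEmbedding]
    constructor
    · rintro ⟨hl, hlc⟩
      have : l ∈ Set.range (S.orderEmbOfFin rfl) := by simpa using hl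
      obtain ⟨i, rfl⟩ := this
      exact ⟨i, hlc, rfl⟩
    · rintro ⟨i, hi, rfl⟩
      exact ⟨Finset.orderEmbOfFin_mem _ _ _, hi⟩
  rw [hS', ← Finset.card_map (T.orderEmbOfFin h).toEmbedding]
  refine Finset.card_le_card fun l hl => ?_
  simp only [Finset.mem_filter, Finset.mem_map, Finset.mem_univ, true_and,
      RelEmbedding.coe_toEmbedding] at hl ⊢
  obtain ⟨i, hi, rfl⟩ := hl
  exact ⟨Finset.orderEmbOfFin_mem _ _ _, (hle i).trans hi⟩

end Lex

/-! ### Greedy bases and dimension -/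

section Greedy

/-- The number of vectors of a finite family that are not in the span of the earlier ones is the
dimension of the span of the family. -/
theorem finrank_span_eq_card_greedy {K V ι β : Type*} [Field K] [AddCommGroup V] [Module K V]
    [Module.Finite K V] [LinearOrder β] (key : ι → β) (hkey : Function.Injective key)
    (w : ι → V) (s : Finset ι) :
    Module.finrank K (Submodule.span K (w '' s)) =
      Nat.card {i // i ∈ s ∧ w i ∉ Submodule.span K (w '' {t | t ∈ s ∧ key t < key i})} := by
  classical
  -- Adding the element of largest key leaves the test for all earlier elements unchanged.
  induction s using Finset.induction_on_max_value key with
  | empty => simp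
  | insert a s ha hmax ih =>
    have hlt : ∀ x ∈ s, key x < key a := fun x hx =>
      lt_of_le_of_ne (hmax x hx) fun h => ha (hkey h ▸ hx)
    have e1 : ∀ i ∈ s, {t | t ∈ insert a s ∧ key t < key i} = {t | t ∈ s ∧ key t < key i} := by
      intro i hi
      ext t
      simp only [Set.mem_ofPred_eq, Finset.mem_insert]
      constructor
      · rintro ⟨rfl | h, h'⟩
        · exact absurd (hlt i hi) (not_lt.2 h'.le)
        · exact ⟨h, h'⟩
      · tauto
    have e2 : {t | t ∈ insert a s ∧ key t < key a} = (s : Set ι) := by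
      ext t
      simp only [Set.mem_ofPred_eq, Finset.mem_insert, Finset.mem_coe]
      constructor
      · rintro ⟨rfl | h, h'⟩
        · exact absurd h' (lt_irrefl _)
        · exact h
      · exact fun h => ⟨Or.inr h, hlt t h⟩
    rw [Finset.coe_insert, Set.image_insert_eq, Submodule.span_insert, sup_comm]
    have cnt : ∀ (t : Finset ι) (p : ι → Prop) [DecidablePred p],
        Nat.card {i // i ∈ t ∧ p i} = (t.filter p).card := by
      intro t p _
      rw [← Nat.card_eq_finsetCard]
      exact Nat.card_congr (Equiv.subtypeEquivRight fun i => by simp)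
    rw [cnt] at ih
    rw [cnt, Finset.filter_insert, e2]
    have e3 : s.filter (fun i => w i ∉ Submodule.span K
        (w '' {t | t ∈ insert a s ∧ key t < key i})) =
        s.filter (fun i => w i ∉ Submodule.span K (w '' {t | t ∈ s ∧ key t < key i})) :=
      Finset.filter_congr fun i hi => by rw [e1 i hi]
    rw [e3]
    split_ifs with h
    · rw [← ih, sup_eq_left.2 ((Submodule.span_singleton_le_iff_mem _ _).2 h)]
    · rw [Finset.card_insert_of_notMem (by simp [ha]), ← ih, Submodule.finrank_sup_span_singleton h]

end Greedy

/-! ### Greedy sets of products of square-zero elements -/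

section GreedySet

variable {n : ℕ} {K : Type*} [Field K]

/-- The sets `S` for which `w S` is not in the span of the `w T` with `|T| = |S|` and `T`
lexicographically smaller than `S`. -/
def greedySet (K : Type*) [Field K] {n : ℕ} {V : Type*} [AddCommGroup V] [Module K V]
    (w : Finset (Fin n) → V) : Set (Finset (Fin n)) :=
  {S | w S ∉ Submodule.span K {x | ∃ T : Finset (Fin n), T.card = S.card ∧ LexLT T S ∧ x = w T}}

theorem notMem_greedySet {V : Type*} [AddCommGroup V] [Module K V] {w : Finset (Fin n) → V}
    {S : Finset (Fin n)} : S ∉ greedySet K w ↔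
      w S ∈ Submodule.span K (w '' {T | T.card = S.card ∧ LexLT T S}) := by
  have : {x | ∃ T : Finset (Fin n), T.card = S.card ∧ LexLT T S ∧ x = w T} =
      w '' {T | T.card = S.card ∧ LexLT T S} := by
    ext x
    constructor
    · rintro ⟨T, h1, h2, rfl⟩
      exact ⟨T, ⟨h1, h2⟩, rfl⟩
    · rintro ⟨T, ⟨h1, h2⟩, rfl⟩
      exact ⟨T, h1, h2, rfl⟩
  rw [← this]
  exact not_not

theorem greedySet_comp_of_injective {V W : Type*} [AddCommGroup V] [Module K V] [AddCommGroup W]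
    [Module K W] (f : V →ₗ[K] W) (hf : Function.Injective f) (w : Finset (Fin n) → V) :
    greedySet K (fun S => f (w S)) = greedySet K w := by
  ext S
  rw [← not_iff_not, notMem_greedySet, notMem_greedySet,
    ← Set.image_image f w, ← Submodule.map_span, Submodule.mem_map]
  exact ⟨fun ⟨y, hy, h⟩ => hf h ▸ hy, fun h => ⟨_, h, rfl⟩⟩

/-- Linear dependence of vectors with coordinates in a field is not affected by enlarging the
field. -/
theorem mem_span_mapRange_iff {K' X : Type*} [Field K'] (φ : K →+* K') (v : X →₀ K)
    (s : Set (X →₀ K)) :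
    v.mapRange φ (map_zero φ) ∈
      Submodule.span K' ((fun x : X →₀ K => x.mapRange φ (map_zero φ)) '' s) ↔
      v ∈ Submodule.span K s := by
  constructor
  · intro h
    by_contra hv
    -- A functional separating `v` from the span over `K` is transported along `φ` and still
    -- separates over `K'`.
    obtain ⟨f, hf, hs⟩ := Submodule.exists_le_ker_of_notMem hv
    let f' : (X →₀ K') →ₗ[K'] K' := Finsupp.linearCombination K' fun x => φ (f (Finsupp.single x 1))
    have hf' : ∀ x : X →₀ K, f' (x.mapRange φ (map_zero φ)) = φ (f x) := by
      intro x
      induction x using Finsupp.induction_linear with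
      | zero => simp
      | add x y hx hy => rw [Finsupp.mapRange_add (map_add φ), map_add, map_add, map_add, hx, hy]
      | single a b =>
        have : Finsupp.single a b = b • Finsupp.single a (1 : K) := by simp
        rw [this, map_smul]
        simp [f']
    have hle : Submodule.span K' ((fun x : X →₀ K => x.mapRange φ (map_zero φ)) '' s) ≤
        LinearMap.ker f' := by
      rw [Submodule.span_le]
      rintro _ ⟨x, hx, rfl⟩
      have : f x = 0 := hs (Submodule.subset_span hx)
      simp [hf', this]
    have := hle h
    rw [LinearMap.mem_ker, hf', map_eq_zero] at this
    exact hf this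
  · intro h
    induction h using Submodule.span_induction with
    | mem x hx => exact Submodule.subset_span ⟨x, hx, rfl⟩
    | zero => simp
    | add x y _ _ hx hy =>
      rw [Finsupp.mapRange_add (map_add φ)]
      exact add_mem hx hy
    | smul a x _ hx =>
      have : (a • x).mapRange φ (map_zero φ) = φ a • x.mapRange φ (map_zero φ) := by
        ext i
        simp
      rw [this]
      exact Submodule.smul_mem _ _ hx

theorem greedySet_mapRange {K' X : Type*} [Field K'] (φ : K →+* K')
    (w : Finset (Fin n) → X →₀ K) :
    greedySet K' (fun S => (w S).mapRange φ (map_zero φ)) = greedySet K w := by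
  ext S
  rw [← not_iff_not, notMem_greedySet, notMem_greedySet, ← mem_span_mapRange_iff φ (w S),
    Set.image_image]

theorem fComplex_greedySet {V : Type*} [AddCommGroup V] [Module K V] [Module.Finite K V]
    (w : Finset (Fin n) → V) (i : ℕ) :
    fComplex (greedySet K w) i = finrank K (Submodule.span K (w '' {T | T.card = i})) := by
  have h := finrank_span_eq_card_greedy (K := K) lexKey lexKey_injective w
    (Finset.univ.filter fun T : Finset (Fin n) => T.card = i)
  have e : ((Finset.univ.filter fun T : Finset (Fin n) => T.card = i : Finset (Finset (Fin n))) :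
      Set (Finset (Fin n))) = {T : Finset (Fin n) | T.card = i} := by
    ext T
    simp
  rw [e] at h
  rw [h]
  refine Nat.card_congr (Equiv.subtypeEquivRight fun S => ?_)
  rw [and_comm]
  simp only [Finset.mem_filter, Finset.mem_univ, true_and]
  refine and_congr_right fun hS => ?_
  rw [← not_iff_not, notMem_greedySet, not_not]
  simp only [lexLT_iff_lexKey, hS]
  rfl

variable {A : Type*} [CommRing A] [Algebra K A] {g : Fin n → A}

/-- Multiply a dependence of the `T`-product on earlier `R`-products by the product over `U = S \
T`. Terms with `R` meeting `U` die because squares vanish; the others are products over `R ∪ U`,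
which precedes `S`. -/
theorem isComplex_greedySet_prod [Nontrivial A] (hg : ∀ i, g i * g i = 0) :
    IsComplex (greedySet K fun S => ∏ i ∈ S, g i) := by
  constructor
  · by_contra h
    rw [notMem_greedySet] at h
    have : {T : Finset (Fin n) | T.card = (∅ : Finset (Fin n)).card ∧ LexLT T ∅} = ∅ := by
      refine Set.eq_empty_of_forall_notMem fun T hT => ?_
      obtain ⟨h1, h2⟩ := hT
      rw [Finset.card_empty, Finset.card_eq_zero] at h1
      subst h1
      obtain ⟨i, hi, -⟩ := lexLT_iff.1 h2
      simp at hi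
    rw [this] at h
    simp at h
  · intro S hS T hTS
    by_contra hT
    rw [notMem_greedySet] at hT
    refine absurd hS (notMem_greedySet.2 ?_)
    set U := S \ T with hU
    have hTU : T ∪ U = S := Finset.union_sdiff_of_subset hTS
    have hd : Disjoint T U := Finset.disjoint_sdiff
    have h1 := Submodule.mem_map_of_mem (f := LinearMap.mulRight K (∏ i ∈ U, g i)) hT
    rw [LinearMap.mulRight_apply, ← Finset.prod_union hd, hTU, Submodule.map_span,
      Set.image_image] at h1
    refine Submodule.span_le.2 ?_ h1
    rintro _ ⟨R, ⟨hR, hRT⟩, rfl⟩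
    simp only [LinearMap.mulRight_apply, SetLike.mem_coe]
    by_cases hRU : Disjoint R U
    · rw [← Finset.prod_union hRU]
      refine Submodule.subset_span ⟨R ∪ U, ⟨?_, ?_⟩, rfl⟩
      · rw [← hTU, Finset.card_union_of_disjoint hRU, Finset.card_union_of_disjoint hd, hR]
      · rw [← hTU]
        exact hRT.union hRU
    · obtain ⟨i, hi, hi'⟩ := Finset.not_disjoint_iff.1 hRU
      rw [← Finset.mul_prod_erase _ _ hi, ← Finset.mul_prod_erase _ _ hi', mul_mul_mul_comm, hg,
        zero_mul]
      exact zero_mem _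

theorem prod_update_add_of_mem {S : Finset (Fin n)} {i j : Fin n} (hi : i ∈ S) :
    ∏ l ∈ S, Function.update g i (g i + g j) l =
      ∏ l ∈ S, g l + g j * ∏ l ∈ S.erase i, g l := by
  rw [← Finset.mul_prod_erase _ _ hi, ← Finset.mul_prod_erase _ g hi, Function.update_self, add_mul]
  have : ∏ l ∈ S.erase i, Function.update g i (g i + g j) l = ∏ l ∈ S.erase i, g l :=
    Finset.prod_congr rfl fun l hl => Function.update_of_ne (Finset.ne_of_mem_erase hl) _ _
  rw [this]

theorem prod_update_of_notMem {S : Finset (Fin n)} {i : Fin n} (hi : i ∉ S) (a : A) :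
    ∏ l ∈ S, Function.update g i a l = ∏ l ∈ S, g l :=
  Finset.prod_congr rfl fun l hl => Function.update_of_ne (fun h => hi (by rwa [← h])) _ _

/-- If `S` is in the greedy set of `g`, then replacing `j ∈ S` by a smaller `i ∉ S` gives an
element of the greedy set of the family with `g i` replaced by `g i + g j`. -/
theorem insert_erase_mem_greedySet_update (hg : ∀ i, g i * g i = 0) {S : Finset (Fin n)}
    {i j : Fin n} (hij : i < j) (hi : i ∉ S) (hj : j ∈ S)
    (hS : S ∈ greedySet K fun S => ∏ i ∈ S, g i) :
    insert i (S.erase j) ∈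
      greedySet K fun S => ∏ l ∈ S, Function.update g i (g i + g j) l := by
  by_contra hT
  rw [notMem_greedySet] at hT
  refine absurd hS (notMem_greedySet.2 ?_)
  set T := insert i (S.erase j) with hTdef
  have hcard : T.card = S.card := by
    rw [Finset.card_insert_of_notMem (by simp [hi]), Finset.card_erase_add_one hj]
  have hTS : LexLT T S := lexLT_insert_erase hij hi
  have hTi : T.erase i = S.erase j := Finset.erase_insert (by simp [hi])
  have mem : ∀ R : Finset (Fin n), R.card = S.card → LexLT R S → ∏ l ∈ R, g l ∈
      Submodule.span K ((fun S => ∏ i ∈ S, g i) '' {T | T.card = S.card ∧ LexLT T S}) :=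
    fun R h1 h2 => Submodule.subset_span ⟨R, ⟨h1, h2⟩, rfl⟩
  -- Expanding an updated product over `R` gives the product over `R` and, if `i ∈ R`, one over `R -
  -- i + j`, which is zero or again precedes `S`.
  have h1 : ∏ l ∈ T, Function.update g i (g i + g j) l ∈
      Submodule.span K ((fun S => ∏ i ∈ S, g i) '' {T | T.card = S.card ∧ LexLT T S}) := by
    refine Submodule.span_le.2 ?_ hT
    rintro _ ⟨R, ⟨hR, hRT⟩, rfl⟩
    have hRS := hRT.trans hTS
    rw [hcard] at hR
    simp only [SetLike.mem_coe]
    by_cases hiR : i ∈ R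
    · rw [prod_update_add_of_mem hiR]
      refine add_mem (mem R hR hRS) ?_
      by_cases hjR : j ∈ R
      · rw [← Finset.mul_prod_erase (R.erase i) g (a := j) (by simp [hjR, hij.ne']), ← mul_assoc,
          hg, zero_mul]
        exact zero_mem _
      · rw [← Finset.prod_insert (by simp [hjR])]
        refine mem _ ?_ (hRT.exchange hj hi hiR hjR)
        rw [Finset.card_insert_of_notMem (by simp [hjR]), Finset.card_erase_add_one hiR, hR]
    · rw [prod_update_of_notMem hiR]
      exact mem R hR hRS
  -- For `T` itself the second term is exactly the product over `S`, which is therefore dependent on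
  -- earlier ones.
  rw [prod_update_add_of_mem (by simp [hTdef]), hTi, Finset.mul_prod_erase _ _ hj] at h1
  exact (Submodule.add_mem_iff_right _ (mem T hcard hTS)).1 h1

end GreedySet

/-! ### The commutative algebra of join operators -/

section JoinAlgebra

set_option linter.unusedSectionVars false

variable {L : Type*} [SemilatticeInf L] [OrderBot L] [GradeMinOrder ℕ L]

/-- The operator `x ↦ x ∨ u` if this join exists and has rank `r x + 1`, and `x ↦ 0` otherwise. -/
def joinOp (K : Type*) [Field K] (u : RankOne L) : Module.End K (L →₀ K) :=
  open Classical in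
  Finsupp.linearCombination K fun x =>
    if h : ∃ y, Step u x y then Finsupp.single h.choose 1 else 0

variable {K : Type*} [Field K]

theorem joinOp_single_of_step {u : RankOne L} {x y : L} (h : Step u x y) :
    joinOp K u (Finsupp.single x 1) = Finsupp.single y 1 := by
  have hex : ∃ y, Step u x y := ⟨y, h⟩
  rw [joinOp, Finsupp.linearCombination_single, one_smul, dif_pos hex, hex.choose_spec.unique h]

theorem joinOp_single_of_not {u : RankOne L} {x : L} (h : ∀ y, ¬ Step u x y) :
    joinOp K u (Finsupp.single x 1) = 0 := by
  rw [joinOp, Finsupp.linearCombination_single, one_smul, dif_neg (not_exists.2 h)]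

theorem joinOp_mapRange {K' : Type*} [Field K'] (φ : K →+* K') (u : RankOne L) (v : L →₀ K) :
    joinOp K' u (v.mapRange φ (map_zero φ)) = (joinOp K u v).mapRange φ (map_zero φ) := by
  induction v using Finsupp.induction_linear with
  | zero => simp
  | add x y hx hy =>
    rw [Finsupp.mapRange_add (map_add φ), map_add, map_add, hx, hy,
      Finsupp.mapRange_add (map_add φ)]
  | single a b =>
    rw [Finsupp.mapRange_single]
    have e1 : Finsupp.single a b = b • Finsupp.single a (1 : K) := by simp
    have e2 : Finsupp.single a (φ b) = φ b • Finsupp.single a (1 : K') := by simp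
    rw [e1, e2, map_smul, map_smul]
    by_cases h : ∃ y, Step u a y
    · obtain ⟨y, hy⟩ := h
      rw [joinOp_single_of_step hy, joinOp_single_of_step hy]
      simp
    · rw [joinOp_single_of_not (not_exists.1 h), joinOp_single_of_not (not_exists.1 h)]
      simp

theorem joinOp_mul_self (u : RankOne L) : joinOp K u * joinOp K u = 0 := by
  refine Finsupp.lhom_ext' fun x => LinearMap.ext_ring ?_
  simp only [LinearMap.comp_apply, Finsupp.lsingle_apply, Module.End.mul_apply,
    LinearMap.zero_apply]
  by_cases h : ∃ y, Step u x y
  · obtain ⟨y, hy⟩ := h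
    rw [joinOp_single_of_step hy, joinOp_single_of_not fun z hz => hz.2.2 hy.2.1]
  · rw [joinOp_single_of_not (not_exists.1 h), map_zero]

variable [Finite L] (hL : IsGeometric L)

include hL in
-- If one order of the two steps succeeds from `x`, `step_comm` supplies the other with the same
-- endpoint; otherwise both compositions kill `x`.
theorem IsGeometric.joinOp_comm (u w : RankOne L) :
    joinOp K u * joinOp K w = joinOp K w * joinOp K u := by
  have key : ∀ (u w : RankOne L) (x y z : L), Step w x y → Step u y z →
      joinOp K u (joinOp K w (Finsupp.single x 1)) =
        joinOp K w (joinOp K u (Finsupp.single x 1)) := by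
    intro u w x y z h₁ h₂
    obtain ⟨y', h₃, h₄⟩ := hL.step_comm h₁ h₂
    rw [joinOp_single_of_step h₁, joinOp_single_of_step h₂, joinOp_single_of_step h₃,
      joinOp_single_of_step h₄]
  have zero : ∀ (u w : RankOne L) (x : L), (¬ ∃ y z, Step w x y ∧ Step u y z) →
      joinOp K u (joinOp K w (Finsupp.single x 1)) = 0 := by
    intro u w x h
    by_cases h' : ∃ y, Step w x y
    · obtain ⟨y, hy⟩ := h'
      rw [joinOp_single_of_step hy, joinOp_single_of_not fun z hz => h ⟨y, z, hy, hz⟩]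
    · rw [joinOp_single_of_not (not_exists.1 h'), map_zero]
  refine Finsupp.lhom_ext' fun x => LinearMap.ext_ring ?_
  simp only [LinearMap.comp_apply, Finsupp.lsingle_apply, Module.End.mul_apply]
  by_cases h : ∃ y z, Step w x y ∧ Step u y z
  · obtain ⟨y, z, h₁, h₂⟩ := h
    exact key u w x y z h₁ h₂
  · by_cases h' : ∃ y z, Step u x y ∧ Step w y z
    · obtain ⟨y, z, h₁, h₂⟩ := h'
      exact (key w u x y z h₁ h₂).symm
    · rw [zero u w x h, zero w u x h']

/-- The algebra generated by the operators `x ↦ x ∨ u`. -/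
def joinSubalgebra (K : Type*) [Field K] (L : Type*) [SemilatticeInf L] [OrderBot L]
    [GradeMinOrder ℕ L] : Subalgebra K (Module.End K (L →₀ K)) :=
  Algebra.adjoin K (Set.range (joinOp K))

/-- The commutative algebra generated by the operators `x ↦ x ∨ u` of a geometric meet
semi-lattice. -/
def JoinAlgebra (K : Type*) [Field K] (_ : IsGeometric L) : Type _ := joinSubalgebra K L

include hL in
theorem joinSubalgebra_mul_comm (a b : joinSubalgebra K L) : a * b = b * a := by
  have h : ∀ u, ∀ x ∈ joinSubalgebra K L, Commute (joinOp K u) x := fun u x hx =>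
    Algebra.commute_of_mem_adjoin_of_forall_mem_commute hx (by
      rintro _ ⟨w, rfl⟩
      exact hL.joinOp_comm u w)
  refine Subtype.ext (Algebra.commute_of_mem_adjoin_of_forall_mem_commute
    (s := Set.range (joinOp K)) b.2 ?_)
  rintro _ ⟨w, rfl⟩
  exact (h w a a.2).symm

/-- The commutative ring structure on the algebra generated by the operators `x ↦ x ∨ u`. -/
abbrev joinSubalgebraCommRing : CommRing (joinSubalgebra K L) :=
  { @Subalgebra.toRing K _ _ Module.End.instRing _ (joinSubalgebra K L) with
    mul_comm := joinSubalgebra_mul_comm hL }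

instance : CommRing (JoinAlgebra K hL) :=
  let _ := joinSubalgebraCommRing (K := K) hL
  inferInstanceAs (CommRing (joinSubalgebra K L))

instance : Algebra K (JoinAlgebra K hL) :=
  let _ := joinSubalgebraCommRing (K := K) hL
  inferInstanceAs (Algebra K (joinSubalgebra K L))

namespace JoinAlgebra

/-- The inclusion into the algebra of operators. -/
def toEnd : JoinAlgebra K hL →ₐ[K] Module.End K (L →₀ K) :=
  (joinSubalgebra K L).val

theorem toEnd_injective : Function.Injective (toEnd (K := K) hL) := Subtype.val_injective

variable (K) in
/-- The generator given by an atom. -/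
def gen (u : RankOne L) : JoinAlgebra K hL :=
  ⟨joinOp K u, Algebra.subset_adjoin ⟨u, rfl⟩⟩

@[simp] theorem toEnd_gen (u : RankOne L) : toEnd hL (gen K hL u) = joinOp K u := rfl

theorem gen_mul_self (u : RankOne L) : gen K hL u * gen K hL u = 0 :=
  toEnd_injective hL (by rw [map_mul, toEnd_gen, joinOp_mul_self, map_zero])

/-- The action on the minimum. -/
def ev : JoinAlgebra K hL →ₗ[K] L →₀ K :=
  (LinearMap.applyₗ (Finsupp.single ⊥ 1)).comp (toEnd hL).toLinearMap

theorem ev_apply (a : JoinAlgebra K hL) : ev hL a = toEnd hL a (Finsupp.single ⊥ 1) := rfl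

theorem ev_one : ev (K := K) hL 1 = Finsupp.single ⊥ 1 := by
  rw [ev_apply, map_one, Module.End.one_apply]

theorem ev_gen_mul (u : RankOne L) (a : JoinAlgebra K hL) :
    ev hL (gen K hL u * a) = joinOp K u (ev hL a) := by
  rw [ev_apply, map_mul, toEnd_gen, Module.End.mul_apply, ev_apply]

/-- Climb to `l` from `⊥` along covers, each of which is a step by some atom. -/
theorem exists_ev_eq_single (l : L) : ∃ a, ev (K := K) hL a = Finsupp.single l 1 := by
  suffices h : ∀ (i : ℕ) (l : L), grade ℕ l = i → ∃ a, ev (K := K) hL a = Finsupp.single l 1 from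
    h _ l rfl
  intro i
  induction i with
  | zero =>
    intro l hl
    have : (⊥ : L) = l := eq_of_le_of_grade_le bot_le (by omega)
    exact ⟨1, by rw [ev_one, this]⟩
  | succ i ih =>
    intro l hl
    obtain ⟨x, hx, hg⟩ := exists_covBy_of_grade_eq_succ hl
    obtain ⟨a, ha⟩ := ih x hg
    obtain ⟨u, hu⟩ := hL.exists_step_to hx
    exact ⟨gen K hL u * a, by rw [ev_gen_mul, ha, joinOp_single_of_step hu]⟩

/-- The vector of `⊥` is cyclic and the algebra commutative: if `a` kills it, then `a (b ⊥) = b (a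
⊥) = 0` for all `b`, so `a = 0`. -/
theorem ev_injective : Function.Injective (ev (K := K) hL) := by
  rw [injective_iff_map_eq_zero]
  intro a ha
  refine toEnd_injective hL ?_
  rw [map_zero]
  refine Finsupp.lhom_ext' fun x => LinearMap.ext_ring ?_
  obtain ⟨b, hb⟩ := exists_ev_eq_single (K := K) hL x
  rw [LinearMap.comp_apply, Finsupp.lsingle_apply, ← hb, ev_apply, ← Module.End.mul_apply,
    ← map_mul, mul_comm, map_mul, Module.End.mul_apply, ← ev_apply, ha]
  simp

instance : Nontrivial (JoinAlgebra K hL) := by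
  refine ⟨1, 0, fun h => ?_⟩
  have := congrArg (ev hL) h
  rw [ev_one, map_zero] at this
  simp at this

/-- The linear form `∑ c_u u` as an element of the join algebra. -/
def lin : (RankOne L →₀ K) →ₗ[K] JoinAlgebra K hL := Finsupp.linearCombination K (gen K hL)

theorem lin_single (u : RankOne L) : lin hL (Finsupp.single u (1 : K)) = gen K hL u := by
  simp [lin]

/-- Cross terms cancel in characteristic 2. This lets a commutative algebra receive the exterior
algebra. -/
theorem lin_mul_self [CharP K 2] (v : RankOne L →₀ K) : lin hL v * lin hL v = 0 := by
  have : CharP (JoinAlgebra K hL) 2 := charP_of_injective_algebraMap' K 2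
  rw [lin, Finsupp.linearCombination_apply, Finsupp.sum, CharTwo.sum_mul_self]
  refine Finset.sum_eq_zero fun u _ => ?_
  rw [smul_mul_smul_comm, gen_mul_self, smul_zero]

open Classical in
-- The vanishing clause covers both a missing join and a join of the wrong rank; its inductive step
-- needs both clauses.
theorem ev_prod_gen {n : ℕ} (σ : Fin n ≃ RankOne L) (S : Finset (Fin n)) :
    (∀ l, IsJoin σ S l → grade ℕ l = S.card →
      ev hL (∏ i ∈ S, gen K hL (σ i)) = Finsupp.single l 1) ∧
    ((∀ l, IsJoin σ S l → grade ℕ l ≠ S.card) → ev hL (∏ i ∈ S, gen K hL (σ i)) = 0) := by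
  induction S using Finset.induction_on with
  | empty =>
    have hb : IsJoin σ (∅ : Finset (Fin n)) ⊥ := by simp [IsJoin]
    refine ⟨fun l hl _ => ?_, fun h => absurd (by simp [grade_bot]) (h ⊥ hb)⟩
    rw [Finset.prod_empty, ev_one, hb.unique hl]
  | insert a S ha ih =>
    rw [Finset.prod_insert ha, ev_gen_mul]
    constructor
    · intro l hl hg
      obtain ⟨x, hx, hxg, hst⟩ := hL.exists_step_of_isJoin_insert ha hl hg
      rw [ih.1 x hx hxg, joinOp_single_of_step hst]
    · intro h
      by_cases h' : ∀ x, IsJoin σ S x → grade ℕ x ≠ S.card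
      · rw [ih.2 h', map_zero]
      · push Not at h'
        obtain ⟨x, hx, hxg⟩ := h'
        rw [ih.1 x hx hxg]
        refine joinOp_single_of_not fun y hy => h y (isJoin_insert hx hy) ?_
        rw [grade_of_covBy hy.1, hxg, Finset.card_insert_of_notMem ha]

end JoinAlgebra

end JoinAlgebra

/-! ### Embedding the exterior face algebra in the join algebra -/

section FaceAlgebra

set_option linter.unusedSectionVars false

variable {L : Type*} [SemilatticeInf L] [OrderBot L] [GradeMinOrder ℕ L] [Finite L]
  (hL : IsGeometric L) {k : Type*} [Field k] [CharP k 2] {n : ℕ} (σ : Fin n ≃ RankOne L)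

/-- The map from the exterior algebra to the join algebra. -/
def extHom (k : Type*) [Field k] [CharP k 2] :
    ExteriorAlgebra k (RankOne L →₀ k) →ₐ[k] JoinAlgebra k hL :=
  ExteriorAlgebra.lift k ⟨JoinAlgebra.lin hL, JoinAlgebra.lin_mul_self hL⟩

theorem extHom_wedge (v : Fin n → RankOne L →₀ k) (S : Finset (Fin n)) :
    extHom hL k (wedge k v S) = ∏ i ∈ S, JoinAlgebra.lin hL (v i) := by
  rw [wedge, ExteriorAlgebra.ιMulti_apply, map_list_prod, List.map_ofFn, List.prod_ofFn]
  simp only [extHom, Function.comp_apply, ExteriorAlgebra.lift_ι_apply]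
  refine (Finset.prod_map Finset.univ (S.orderEmbOfFin rfl).toEmbedding
    fun i => JoinAlgebra.lin hL (v i)).symm.trans ?_
  congr 1
  ext i
  simp

theorem stdBasis_apply (i : Fin n) : stdBasis k σ i = Finsupp.single (σ i) 1 := by
  simp [stdBasis]

theorem extHom_wedge_stdBasis (S : Finset (Fin n)) :
    extHom hL k (wedge k (stdBasis k σ) S) = ∏ i ∈ S, JoinAlgebra.gen k hL (σ i) := by
  rw [extHom_wedge]
  exact Finset.prod_congr rfl fun i _ => by rw [stdBasis_apply, JoinAlgebra.lin_single]

theorem ev_extHom_of_isJoin {S : Finset (Fin n)} {l : L} (hl : IsJoin σ S l)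
    (hg : grade ℕ l = S.card) :
    JoinAlgebra.ev hL (extHom hL k (wedge k (stdBasis k σ) S)) = Finsupp.single l 1 := by
  rw [extHom_wedge_stdBasis]
  exact (JoinAlgebra.ev_prod_gen hL σ S).1 l hl hg

theorem ev_extHom_of_forall_ne {S : Finset (Fin n)}
    (h : ∀ l, IsJoin σ S l → grade ℕ l ≠ S.card) :
    JoinAlgebra.ev hL (extHom hL k (wedge k (stdBasis k σ) S)) = 0 := by
  rw [extHom_wedge_stdBasis]
  exact (JoinAlgebra.ev_prod_gen hL σ S).2 h

omit [CharP k 2] [Finite L] in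
theorem not_isJoin_of_isJoinTop {S : Finset (Fin n)} (h : IsJoinTop σ S) (l : L) :
    ¬ IsJoin σ S l := by
  intro hl
  refine absurd (h.2 (show (l : WithTop L) ∈ _ from ?_)) (by simp)
  rintro _ ⟨i, hi, rfl⟩
  exact WithTop.coe_le_coe.2 (hl.1 ⟨i, hi, rfl⟩)

omit [CharP k 2] in
theorem isJoinTop_of_not_isJoin {S : Finset (Fin n)} (h : ∀ l, ¬ IsJoin σ S l) :
    IsJoinTop σ S := by
  refine ⟨fun _ _ => le_top, fun x hx => ?_⟩
  induction x using WithTop.recTopCoe with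
  | top => exact le_rfl
  | coe y =>
    obtain ⟨j, hj⟩ := exists_isLUB_of_bddAbove (s := (fun i => (σ i : L)) '' (S : Set (Fin n)))
      ⟨y, by
        rintro _ ⟨i, hi, rfl⟩
        exact WithTop.coe_le_coe.1 (hx ⟨i, hi, rfl⟩)⟩
    exact absurd hj (h j)

theorem faceIdeal_le_ker : faceIdeal k σ ≤ TwoSidedIdeal.ker (extHom hL k) := by
  rw [faceIdeal, TwoSidedIdeal.span_le]
  intro w hw
  rw [SetLike.mem_coe, TwoSidedIdeal.mem_ker]
  refine JoinAlgebra.ev_injective hL ?_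
  rw [map_zero]
  rcases hw with (⟨S, hS, rfl⟩ | ⟨S, l, hl, hg, rfl⟩) | ⟨S, T, l, hS, hT, hgS, hgT, -, rfl⟩
  · exact ev_extHom_of_forall_ne hL σ fun l hl => absurd hl (not_isJoin_of_isJoinTop σ hS l)
  · exact ev_extHom_of_forall_ne hL σ fun l' hl' => by rwa [hl'.unique hl]
  · rw [map_sub, map_sub, ev_extHom_of_isJoin hL σ hS hgS, ev_extHom_of_isJoin hL σ hT hgT,
      sub_self]

/-- The map from the exterior face algebra to the join algebra. -/
def faceHom (k : Type*) [Field k] [CharP k 2] : FaceAlgebra k σ →ₐ[k] JoinAlgebra k hL :=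
  (faceIdeal k σ).ringCon.liftₐ (extHom hL k)
    (TwoSidedIdeal.ringCon_le_iff.1 (faceIdeal_le_ker (k := k) hL σ))

theorem faceHom_mk (w : ExteriorAlgebra k (RankOne L →₀ k)) :
    faceHom hL σ k ((faceIdeal k σ).ringCon.mk' w) = extHom hL k w := rfl

theorem faceHom_faceWedge (v : Fin n → RankOne L →₀ k) (S : Finset (Fin n)) :
    faceHom hL σ k (faceWedge k σ v S) = ∏ i ∈ S, JoinAlgebra.lin hL (v i) := by
  rw [faceWedge, faceHom_mk, extHom_wedge]

omit [CharP k 2] in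
theorem faceWedge_eq_zero {S : Finset (Fin n)}
    (h : ∀ l, IsJoin σ S l → grade ℕ l ≠ S.card) : faceWedge k σ (stdBasis k σ) S = 0 := by
  have : wedge k (stdBasis k σ) S ∈ faceIdeal k σ := by
    refine TwoSidedIdeal.subset_span ?_
    by_cases h' : ∃ l, IsJoin σ S l
    · obtain ⟨l, hl⟩ := h'
      exact Or.inl (Or.inr ⟨S, l, hl, h l hl, rfl⟩)
    · exact Or.inl (Or.inl ⟨S, isJoinTop_of_not_isJoin σ (not_exists.1 h'), rfl⟩)
  exact Quotient.sound' this

omit [CharP k 2] [Finite L] in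
theorem faceWedge_eq_of_isJoin {S T : Finset (Fin n)} {l : L} (hS : IsJoin σ S l)
    (hT : IsJoin σ T l) (hgS : grade ℕ l = S.card) (hgT : grade ℕ l = T.card) :
    faceWedge k σ (stdBasis k σ) S = faceWedge k σ (stdBasis k σ) T := by
  by_cases hST : S = T
  · rw [hST]
  · have : wedge k (stdBasis k σ) S - wedge k (stdBasis k σ) T ∈ faceIdeal k σ :=
      TwoSidedIdeal.subset_span (Or.inr ⟨S, T, l, hS, hT, hgS, hgT, hST, rfl⟩)
    exact Quotient.sound' (((faceIdeal k σ).rel_iff _ _).2 this)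

omit [CharP k 2] [Finite L] in
theorem exteriorAlgebra_stdBasis_apply (S : Finset (Fin n)) :
    (stdBasis k σ).ExteriorAlgebra S = wedge k (stdBasis k σ) S := by
  rw [ExteriorAlgebra.basis_apply]
  rfl

/-- A left inverse sends `l` to the class of `e_S` for a chosen independent `S` with join `l`. The
third family of relations makes the choice immaterial, the first two kill the remaining `e_S`. -/
theorem faceHom_injective : Function.Injective (faceHom hL σ k) := by
  classical
  let s : (L →₀ k) →ₗ[k] FaceAlgebra k σ := Finsupp.linearCombination k fun l =>
    -- The default `0` is never reached in the check below, where `l` always comes from such an `S`.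
    if h : ∃ S, IsJoin σ S l ∧ grade ℕ l = S.card then
      faceWedge k σ (stdBasis k σ) h.choose else 0
  have key : (s ∘ₗ JoinAlgebra.ev hL) ∘ₗ (extHom hL k).toLinearMap =
      ((faceIdeal k σ).ringCon.mkₐ k).toLinearMap := by
    refine (stdBasis k σ).ExteriorAlgebra.ext fun S => ?_
    rw [exteriorAlgebra_stdBasis_apply]
    simp only [LinearMap.comp_apply, AlgHom.toLinearMap_apply]
    change _ = faceWedge k σ (stdBasis k σ) S
    by_cases h : ∃ l, IsJoin σ S l ∧ grade ℕ l = S.card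
    · obtain ⟨l, hl, hg⟩ := h
      have hex : ∃ S, IsJoin σ S l ∧ grade ℕ l = S.card := ⟨S, hl, hg⟩
      rw [ev_extHom_of_isJoin hL σ hl hg]
      simp only [s, Finsupp.linearCombination_single, one_smul, dif_pos hex]
      exact faceWedge_eq_of_isJoin σ hex.choose_spec.1 hl hex.choose_spec.2 hg
    · push Not at h
      rw [ev_extHom_of_forall_ne hL σ h, faceWedge_eq_zero σ h, map_zero]
  have hinv : Function.LeftInverse (fun a => s (JoinAlgebra.ev hL a)) (faceHom hL σ k) := by
    intro x
    obtain ⟨w, rfl⟩ := (faceIdeal k σ).ringCon.mk'_surjective x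
    exact LinearMap.congr_fun key w
  exact hinv.injective

/-- The coordinates of the element of the join algebra corresponding to `b_S`, where the entry
`M u i` is the coefficient of `u` in `b_i`. -/
def coord {K : Type*} [Field K] (M : RankOne L → Fin n → K) (S : Finset (Fin n)) : L →₀ K :=
  JoinAlgebra.ev hL (∏ i ∈ S, JoinAlgebra.lin hL (Finsupp.equivFunOnFinite.symm fun u => M u i))

/-- The right side does not mention `σ`, which is how independence of the ordering of atoms arises.
-/
theorem shiftWrt_eq_greedySet_coord (B : Basis (Fin n) k (RankOne L →₀ k)) :
    shiftWrt k σ B = greedySet k (coord hL fun u i => B i u) := by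
  have h := greedySet_comp_of_injective (K := k) (JoinAlgebra.ev hL ∘ₗ (faceHom hL σ k).toLinearMap)
    ((JoinAlgebra.ev_injective hL).comp (faceHom_injective hL σ)) (faceWedge k σ B)
  refine Eq.trans (show shiftWrt k σ B = greedySet k (faceWedge k σ B) from rfl) (h.symm.trans ?_)
  congr 1
  ext1 S
  rw [LinearMap.comp_apply, AlgHom.toLinearMap_apply, faceHom_faceWedge, coord]
  congr 1
  refine Finset.prod_congr rfl fun i _ => congrArg _ ?_
  ext u
  simp

end FaceAlgebra

/-! ### Coordinates: change of field and the `f`-vector -/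

section Coord

variable {L : Type*} [SemilatticeInf L] [OrderBot L] [GradeMinOrder ℕ L] [Finite L]
  (hL : IsGeometric L) {K : Type*} [Field K] {n : ℕ}

theorem ev_lin_mul (v : RankOne L →₀ K) (a : JoinAlgebra K hL) :
    JoinAlgebra.ev hL (JoinAlgebra.lin hL v * a) =
      v.sum fun u c => c • joinOp K u (JoinAlgebra.ev hL a) := by
  rw [JoinAlgebra.lin, Finsupp.linearCombination_apply, Finsupp.sum, Finset.sum_mul, map_sum]
  refine Finset.sum_congr rfl fun u _ => ?_
  rw [smul_mul_assoc, map_smul, JoinAlgebra.ev_gen_mul]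

theorem coord_insert [Fintype (RankOne L)] (M : RankOne L → Fin n → K) {S : Finset (Fin n)}
    {a : Fin n} (ha : a ∉ S) :
    coord hL M (insert a S) = ∑ u, M u a • joinOp K u (coord hL M S) := by
  rw [coord, Finset.prod_insert ha, ev_lin_mul, Finsupp.sum_fintype _ _ (by simp)]
  rfl

/-- The join operators have matrix entries `0` and `1`, so coordinates are integer polynomials in
the entries of `M`. -/
theorem coord_map {K' : Type*} [Field K'] (φ : K →+* K') (M : RankOne L → Fin n → K)
    (S : Finset (Fin n)) :
    coord hL (fun u i => φ (M u i)) S = (coord hL M S).mapRange φ (map_zero φ) := by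
  have := Fintype.ofFinite (RankOne L)
  induction S using Finset.induction_on with
  | empty => simp [coord, JoinAlgebra.ev_one]
  | insert a S ha ih =>
    rw [coord_insert hL _ ha, coord_insert hL _ ha, ih]
    change _ = Finsupp.mapRange.addMonoidHom φ.toAddMonoidHom _
    rw [map_sum]
    refine Finset.sum_congr rfl fun u _ => ?_
    rw [joinOp_mapRange]
    ext l
    simp

theorem greedySet_coord_map {K' : Type*} [Field K'] (φ : K →+* K') (M : RankOne L → Fin n → K) :
    greedySet K' (coord hL fun u i => φ (M u i)) = greedySet K (coord hL M) := by
  rw [← greedySet_mapRange φ (coord hL M)]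
  congr 1
  ext1 S
  exact coord_map hL φ M S

theorem greedySet_coord (M : RankOne L → Fin n → K) : greedySet K (coord hL M) =
    greedySet K fun S => ∏ i ∈ S, JoinAlgebra.lin hL (Finsupp.equivFunOnFinite.symm fun u => M u i) :=
  greedySet_comp_of_injective (JoinAlgebra.ev (K := K) hL) (JoinAlgebra.ev_injective hL)
    fun S => ∏ i ∈ S, JoinAlgebra.lin hL (Finsupp.equivFunOnFinite.symm fun u => M u i)

theorem isComplex_greedySet_coord [CharP K 2] (M : RankOne L → Fin n → K) :
    IsComplex (greedySet K (coord hL M)) := by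
  rw [greedySet_coord]
  exact isComplex_greedySet_prod fun i => JoinAlgebra.lin_mul_self hL _

/-- If the vectors `b_i` span, then the `b_S` with `|S| = i` span the part of rank `i`. -/
theorem span_coord_eq_supported [CharP K 2] (B : Basis (Fin n) K (RankOne L →₀ K)) (i : ℕ) :
    Submodule.span K (coord hL (fun u j => B j u) '' {T | T.card = i}) =
      Finsupp.supported K K {l : L | grade ℕ l = i} := by
  set M : RankOne L → Fin n → K := fun u j => B j u with hM
  have hBM : ∀ j, (Finsupp.equivFunOnFinite.symm fun u => M u j) = B j := fun j => by
    ext u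
    simp [hM]
  have := Fintype.ofFinite (RankOne L)
  have hop : ∀ (u : RankOne L) (i : ℕ), Finsupp.supported K K {l : L | grade ℕ l = i} ≤
      (Finsupp.supported K K {l : L | grade ℕ l = i + 1}).comap (joinOp K u) := by
    intro u i
    rw [Finsupp.supported_eq_span_single, Submodule.span_le]
    rintro _ ⟨l, hl, rfl⟩
    simp only [SetLike.mem_coe, Submodule.mem_comap]
    by_cases h : ∃ y, Step u l y
    · obtain ⟨y, hy⟩ := h
      rw [joinOp_single_of_step hy]
      refine Finsupp.single_mem_supported K _ ?_
      have := grade_of_covBy hy.1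
      change grade ℕ l = i at hl
      change grade ℕ y = i + 1
      omega
    · rw [joinOp_single_of_not (not_exists.1 h)]
      exact zero_mem _
  have hle : ∀ T : Finset (Fin n),
      coord hL M T ∈ Finsupp.supported K K {l : L | grade ℕ l = T.card} := by
    intro T
    induction T using Finset.induction_on with
    | empty =>
      rw [coord, Finset.prod_empty, JoinAlgebra.ev_one]
      exact Finsupp.single_mem_supported K _ (grade_bot (𝕆 := ℕ) (α := L))
    | insert a S ha ih =>
      rw [coord_insert hL _ ha, Finset.card_insert_of_notMem ha]
      exact Submodule.sum_mem _ fun u _ => Submodule.smul_mem _ _ (hop u _ ih)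
  refine le_antisymm (Submodule.span_le.2 ?_) ?_
  · rintro _ ⟨T, rfl, rfl⟩
    exact hle T
  · induction i with
    | zero =>
      rw [Finsupp.supported_eq_span_single, Submodule.span_le]
      rintro _ ⟨l, hl, rfl⟩
      refine Submodule.subset_span ⟨∅, rfl, ?_⟩
      have hl' : grade ℕ l = 0 := hl
      have : (⊥ : L) = l := eq_of_le_of_grade_le bot_le (by omega)
      rw [coord, Finset.prod_empty, JoinAlgebra.ev_one, this]
    | succ i ih =>
      -- Expanding `v` in `B` turns multiplication by `v` into multiplications by the `b_j`: those
      -- with `j ∈ T` give zero, the rest give `b_{T ∪ j}`.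
      have hstep : ∀ v : RankOne L →₀ K, ∀ T : Finset (Fin n), T.card = i →
          (v.sum fun u c => c • joinOp K u (coord hL M T)) ∈
          Submodule.span K (coord hL M '' {T | T.card = i + 1}) := by
        intro v T hT
        rw [coord, ← ev_lin_mul, ← B.sum_repr v, map_sum, Finset.sum_mul, map_sum]
        refine Submodule.sum_mem _ fun j _ => ?_
        rw [map_smul, smul_mul_assoc, map_smul]
        refine Submodule.smul_mem _ _ ?_
        rw [← hBM j]
        by_cases hj : j ∈ T
        · rw [← Finset.mul_prod_erase _ _ hj, ← mul_assoc, JoinAlgebra.lin_mul_self, zero_mul,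
            map_zero]
          exact zero_mem _
        · refine Submodule.subset_span ⟨insert j T, ?_, ?_⟩
          · rw [Set.mem_ofPred_eq, Finset.card_insert_of_notMem hj, hT]
          · rw [coord, Finset.prod_insert hj]
      rw [Finsupp.supported_eq_span_single, Submodule.span_le]
      rintro _ ⟨l, hl, rfl⟩
      obtain ⟨x, hx, hg⟩ := exists_covBy_of_grade_eq_succ hl
      obtain ⟨u, hu⟩ := hL.exists_step_to hx
      have hxmem : Finsupp.single x 1 ∈ Submodule.span K (coord hL M '' {T | T.card = i}) :=
        ih (Finsupp.single_mem_supported K _ hg)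
      have hcomap : Submodule.span K (coord hL M '' {T | T.card = i}) ≤
          (Submodule.span K (coord hL M '' {T | T.card = i + 1})).comap (joinOp K u) := by
        rw [Submodule.span_le]
        rintro _ ⟨T, hT, rfl⟩
        have := hstep (Finsupp.single u 1) T hT
        rwa [Finsupp.sum_single_index (by simp), one_smul] at this
      have := hcomap hxmem
      rwa [Submodule.mem_comap, joinOp_single_of_step hu] at this

theorem fComplex_greedySet_coord [CharP K 2] (B : Basis (Fin n) K (RankOne L →₀ K)) (i : ℕ) :
    fComplex (greedySet K (coord hL fun u j => B j u)) i = fPoset L i := by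
  rw [fComplex_greedySet, span_coord_eq_supported, fPoset,
    (Finsupp.supportedEquivFinsupp {l : L | grade ℕ l = i}).finrank_eq]
  have := Fintype.ofFinite {l : L | grade ℕ l = i}
  rw [Module.finrank_finsupp_self, ← Nat.card_eq_fintype_card]
  rfl

end Coord

/-! ### Genericity, canonicity and shiftedness -/

section Generic

set_option linter.unusedSectionVars false

variable {L : Type*} [SemilatticeInf L] [OrderBot L] [GradeMinOrder ℕ L] [Finite L]
  (hL : IsGeometric L) {n : ℕ}

/-- The entries of `M` are algebraically independent over the prime field `ℤ/2`. -/
def PrimeGeneric {X K : Type*} [Field K] [CharP K 2] (M : X → Fin n → K) : Prop :=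
  Function.Injective
    (MvPolynomial.eval₂Hom (ZMod.castHom (dvd_refl 2) K) fun p : X × Fin n => M p.1 p.2)

/-- Evaluation over `ℤ/2` factors through the injection of polynomials over `ℤ/2` into polynomials
over `F`. -/
theorem primeGeneric_of_algebraicIndependent {X F K : Type*} [Field F] [Field K] [Algebra F K]
    [CharP K 2] {M : X → Fin n → K}
    (h : AlgebraicIndependent F fun p : X × Fin n => M p.1 p.2) : PrimeGeneric M := by
  have : CharP F 2 := (Algebra.charP_iff F K 2).2 inferInstance
  have e : MvPolynomial.eval₂Hom (ZMod.castHom (dvd_refl 2) K) (fun p : X × Fin n => M p.1 p.2) =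
      (MvPolynomial.aeval (R := F) fun p : X × Fin n => M p.1 p.2 :
        MvPolynomial (X × Fin n) F →+* K).comp
        (MvPolynomial.map (ZMod.castHom (dvd_refl 2) F)) := by
    refine MvPolynomial.ringHom_ext' (RingHom.ext_zmod _ _) fun p => ?_
    simp
  rw [PrimeGeneric, e, RingHom.coe_comp]
  exact Function.Injective.comp (g := MvPolynomial.aeval fun p : X × Fin n => M p.1 p.2) h
    (MvPolynomial.map_injective _ (RingHom.injective _))

/-- A generic matrix over `ℤ/2`. -/
def primeMatrix (X : Type*) (n : ℕ) (u : X) (i : Fin n) :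
    FractionRing (MvPolynomial (X × Fin n) (ZMod 2)) :=
  algebraMap (MvPolynomial (X × Fin n) (ZMod 2)) _ (MvPolynomial.X (u, i))

/-- Injective evaluation extends to an embedding of the rational function field over `ℤ/2` carrying
the universal matrix to `M`, and greedy sets do not change under field embeddings. -/
theorem PrimeGeneric.greedySet_coord {K : Type*} [Field K] [CharP K 2] {M : RankOne L → Fin n → K}
    (hM : PrimeGeneric M) :
    greedySet K (coord hL M) =
      greedySet (FractionRing (MvPolynomial (RankOne L × Fin n) (ZMod 2)))
        (coord hL (primeMatrix (RankOne L) n)) := by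
  have hM' : Function.Injective (MvPolynomial.eval₂Hom (ZMod.castHom (dvd_refl 2) K)
      fun p : RankOne L × Fin n => M p.1 p.2) := hM
  rw [← greedySet_coord_map hL (IsFractionRing.lift hM') (primeMatrix (RankOne L) n)]
  congr 2
  ext u i
  rw [primeMatrix, IsFractionRing.lift_algebraMap]
  simp

/-- Adding one column of a generic matrix to another one gives a generic matrix. -/
theorem PrimeGeneric.add_column {X K : Type*} [Field K] [CharP K 2] {M : X → Fin n → K}
    (hM : PrimeGeneric M) {i j : Fin n} (hij : i ≠ j) :
    PrimeGeneric fun u => Function.update (M u) i (M u i + M u j) := by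
  let τ : MvPolynomial (X × Fin n) (ZMod 2) →+* MvPolynomial (X × Fin n) (ZMod 2) :=
    MvPolynomial.eval₂Hom MvPolynomial.C fun p =>
      Function.update (fun l => MvPolynomial.X (p.1, l)) i
        (MvPolynomial.X (p.1, i) + MvPolynomial.X (p.1, j)) p.2
  have hτ : ∀ u l, l ≠ i → τ (MvPolynomial.X (u, l)) = MvPolynomial.X (u, l) := fun u l h => by
    simp [τ, h]
  have hτi : ∀ u, τ (MvPolynomial.X (u, i)) =
      MvPolynomial.X (u, i) + MvPolynomial.X (u, j) := fun u => by
    simp [τ]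
  -- In characteristic 2 the substitution is an involution, hence injective.
  have hττ : τ.comp τ = RingHom.id _ := by
    refine MvPolynomial.ringHom_ext' (RingHom.ext_zmod _ _) fun p => ?_
    obtain ⟨u, l⟩ := p
    rw [RingHom.comp_apply, RingHom.id_apply]
    by_cases h : l = i
    · subst h
      rw [hτi, map_add, hτi, hτ u j hij.symm, add_assoc, CharTwo.add_self_eq_zero, add_zero]
    · rw [hτ u l h, hτ u l h]
  have e : MvPolynomial.eval₂Hom (ZMod.castHom (dvd_refl 2) K)
      (fun p : X × Fin n => Function.update (M p.1) i (M p.1 i + M p.1 j) p.2) =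
      (MvPolynomial.eval₂Hom (ZMod.castHom (dvd_refl 2) K) fun p : X × Fin n => M p.1 p.2).comp
        τ := by
    refine MvPolynomial.ringHom_ext' (RingHom.ext_zmod _ _) fun p => ?_
    obtain ⟨u, l⟩ := p
    rw [RingHom.comp_apply]
    by_cases h : l = i
    · subst h
      rw [hτi]
      simp
    · rw [hτ u l h]
      simp [h]
  rw [PrimeGeneric, e, RingHom.coe_comp]
  exact Function.Injective.comp hM
    (Function.LeftInverse.injective (g := τ) fun x => by
      rw [← RingHom.comp_apply, hττ, RingHom.id_apply])

/-- The exchange lands in the greedy set of the matrix after a column addition; that matrix is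
generic too, so its greedy set is the original one. -/
theorem PrimeGeneric.isShifted {K : Type*} [Field K] [CharP K 2] {M : RankOne L → Fin n → K}
    (hM : PrimeGeneric M) : IsShifted (greedySet K (coord hL M)) := by
  refine isShifted_of_exchange fun S hS i j hij hi hj => ?_
  rw [hM.greedySet_coord hL, ← (hM.add_column hij.ne).greedySet_coord hL,
    GeometricShift.greedySet_coord]
  rw [GeometricShift.greedySet_coord] at hS
  have h := insert_erase_mem_greedySet_update (fun l => JoinAlgebra.lin_mul_self hL _) hij hi hj hS
  convert h using 5 with T l
  by_cases hl : l = i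
  · subst hl
    rw [Function.update_self, ← map_add]
    congr 1
    ext u
    simp
  · rw [Function.update_of_ne hl]
    congr 1
    ext u
    simp [hl]

theorem IsGeneric.primeGeneric {k : Type*} [Field k] [CharP k 2] {σ : Fin n ≃ RankOne L}
    {B : Basis (Fin n) k (RankOne L →₀ k)} (hB : IsGeneric k σ B) :
    PrimeGeneric fun u i => B i u := by
  obtain ⟨F, hF⟩ := hB
  have h := hF.comp (Prod.map σ.symm id : RankOne L × Fin n → Fin n × Fin n)
    (Function.Injective.prodMap σ.symm.injective Function.injective_id)
  refine primeGeneric_of_algebraicIndependent (F := F) ?_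
  convert h using 1
  ext p
  simp [Basis.toMatrix_apply, stdBasis]

instance charP_genericField (k : Type*) [Field k] [CharP k 2] : CharP (GenericField k n) 2 :=
  charP_of_injective_algebraMap' k 2

theorem primeGeneric_genericBasis (k : Type*) [Field k] [CharP k 2] (σ : Fin n ≃ RankOne L) :
    PrimeGeneric fun u i => genericBasis k σ i u := by
  have h : AlgebraicIndependent k fun p : Fin n × Fin n =>
      algebraMap (MvPolynomial (Fin n × Fin n) k) (GenericField k n) (MvPolynomial.X p) :=
    (MvPolynomial.algebraicIndependent_X (Fin n × Fin n) k).map'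
      (f := Algebra.algHom k (MvPolynomial (Fin n × Fin n) k) (GenericField k n))
      (IsFractionRing.injective _ _)
  have e : (fun p : RankOne L × Fin n => genericBasis k σ p.2 p.1) =
      (fun p : Fin n × Fin n =>
        algebraMap (MvPolynomial (Fin n × Fin n) k) (GenericField k n) (MvPolynomial.X p)) ∘
      (Prod.map σ.symm id : RankOne L × Fin n → Fin n × Fin n) := by
    ext1 ⟨u, i⟩
    have := congrFun (congrFun (stdBasis_toMatrix_genericBasis k σ) (σ.symm u)) i
    simpa [Basis.toMatrix_apply, stdBasis, genericMatrix, Prod.map] using this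
  refine primeGeneric_of_algebraicIndependent (F := k) ?_
  rw [e]
  exact h.comp _ (Function.Injective.prodMap σ.symm.injective Function.injective_id)

theorem genericShift_eq_greedySet (k : Type*) [Field k] [CharP k 2] (σ : Fin n ≃ RankOne L) :
    genericShift k σ = greedySet (GenericField k n) (coord hL fun u i => genericBasis k σ i u) :=
  shiftWrt_eq_greedySet_coord hL σ _

end Generic

end GeometricShift

end

theorem mainTheorem2 (L : Type*) [SemilatticeInf L] [OrderBot L] [Finite L]
    [GradeMinOrder ℕ L] (hL : GeometricShift.IsGeometric L)
    (k : Type*) [Field k] [CharP k 2]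
    (n : ℕ) (σ : Fin n ≃ GeometricShift.RankOne L) :
    GeometricShift.IsComplex (GeometricShift.genericShift k σ) ∧
    GeometricShift.IsShifted (GeometricShift.genericShift k σ) ∧
    (∀ i : ℕ, GeometricShift.fComplex (GeometricShift.genericShift k σ) i =
      GeometricShift.fPoset L i) ∧
    (∀ (k' : Type*) [Field k'] [CharP k' 2] (σ' : Fin n ≃ GeometricShift.RankOne L),
      GeometricShift.genericShift k' σ' = GeometricShift.genericShift k σ ∧
      ∀ B : Module.Basis (Fin n) k' (GeometricShift.RankOne L →₀ k'),
        GeometricShift.IsGeneric k' σ' B →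
          GeometricShift.shiftWrt k' σ' B = GeometricShift.genericShift k σ) := by
  -- The greedy set of the universal matrix over `ℤ/2` is the common value for all fields, orderings
  -- and generic bases.
  have hk := (GeometricShift.genericShift_eq_greedySet hL k σ).trans
    ((GeometricShift.primeGeneric_genericBasis k σ).greedySet_coord hL)
  refine ⟨?_, ?_, fun i => ?_, fun k' _ _ σ' => ⟨?_, fun B hB => ?_⟩⟩
  · rw [GeometricShift.genericShift_eq_greedySet hL]
    exact GeometricShift.isComplex_greedySet_coord hL _
  · rw [GeometricShift.genericShift_eq_greedySet hL]
    exact (GeometricShift.primeGeneric_genericBasis k σ).isShifted hL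
  · rw [GeometricShift.genericShift_eq_greedySet hL]
    exact GeometricShift.fComplex_greedySet_coord hL _ i
  · rw [hk, GeometricShift.genericShift_eq_greedySet hL]
    exact (GeometricShift.primeGeneric_genericBasis k' σ').greedySet_coord hL
  · rw [hk, GeometricShift.shiftWrt_eq_greedySet_coord hL]
    exact hB.primeGeneric.greedySet_coord hL
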